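/- Let $R_0>1$ and $R_c>0$, let $(N_t)_{t\ge 0}$ and $(N^c_t)_{t\ge 0}$ be independent Poisson processes of rates $R_0$ (free server) and $R_c$ (costly server), and put $R_1=R_0+R_c$. For $R>1$ let $I(R)$ be the largest root of $\gamma(r)=r+R(e^{-r}-1)$, and let $\alpha_0=I(R_0)$, $\alpha_1=I(R_1)$; assume $\alpha_0<2$. For $T\in(-\infty,\infty]$ the online risky policy $\pi^T$ uses the costly server (in addition to the free one) exactly when the buffer size lies in $(0,T)$, i.e. $\pi^T(q)=1$ if $0<q<T$ and $\pi^T(q)=0$ otherwise. With initial buffer size $D$, the buffer size under $\pi^T$ is the process $Q$ that satisfies, almost surely for all $t\ge 0$, $$Q_t = D+N_t+\int_0^t \pi^T(Q_{s-})\,dN^c_s - t .$$ The interruption time is $\tau_0=\inf\{t\ge 0: Q_t=0\}$ (with $\inf\emptyset=\infty$), and the policy is called $(D,\varepsilon)$-feasible if $\mathbb P(\tau_0<\infty)\le\varepsilon$. Let $$\beta=\frac{\alpha_1}{\alpha_0\left(1-\frac{\alpha_0}{2}\right)},\qquad \bar D=\frac1{\alpha_1}\log\frac{\beta}{\varepsilon}.$$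 **Theorem.** Let $\varepsilon>0$ and $\frac1{\alpha_1}\log\frac1\varepsilon\le D\le\frac1{\alpha_0}\log\frac1\varepsilon$. Then the policy $\pi^T$ is $(D,\varepsilon)$-feasible for every threshold $T\ge T^*$, where $$T^*=\begin{cases}\dfrac{1}{\alpha_1-\alpha_0}\left[\log\dfrac{\beta}{\varepsilon}-\alpha_0D\right], & D\ge\bar D,\\[2ex] \dfrac1{\alpha_1}\log\left(\dfrac{\varepsilon+\beta(1-e^{-\alpha_1D})-1}{\varepsilon-e^{-\alpha_1D}}\right), & D\le\bar D.\end{cases}$$ The two formulas agree at $D=\bar D$. On the boundary $D=\frac1{\alpha_1}\log\frac1\varepsilon$, where the denominator in the second formula vanishes, $T^*$ is understood as $+\infty$. -/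

import Mathlib

open MeasureTheory ProbabilityTheory Set
open scoped NNReal ENNReal

noncomputable section

namespace Streaming

/-- The roots of `γ(r) = r + R (e^{-r} - 1)`. -/
def exponentRoots (R : ℝ) : Set ℝ :=
  {r : ℝ | r + R * (Real.exp (-r) - 1) = 0}

/-- `I(R)`: the largest root of `γ(r) = r + R (e^{-r} - 1)`. -/
def exponent (R : ℝ) : ℝ :=
  sSup (exponentRoots R)

/-- For a nonnegative rate the supremum defining `I(R)` is attained, so that `I(R)` really is the
largest root. -/
theorem isGreatest_exponent {R : ℝ} (hR : 0 ≤ R) : IsGreatest (exponentRoots R) (exponent R) := by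
  have hclosed : IsClosed (exponentRoots R) :=
    isClosed_eq (by fun_prop) continuous_const
  have hne : (exponentRoots R).Nonempty := ⟨0, by simp [exponentRoots]⟩
  have hbdd : BddAbove (exponentRoots R) := by
    refine ⟨R, fun r hr => ?_⟩
    have h : r + R * (Real.exp (-r) - 1) = 0 := hr
    nlinarith [mul_nonneg hR (Real.exp_pos (-r)).le]
  exact hclosed.isGreatest_csSup hne hbdd

/-- `N` is a (homogeneous) Poisson process of rate `R` on the probability space `(Ω, P)`: a counting
process started at `0`, with independent increments, whose increment over `[s, t]` is Poisson
distributed with mean `R (t - s)`, and with nondecreasing right-continuous paths.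
(As the paths are nondecreasing, the subtraction of natural numbers is the true one.) -/
structure IsPoissonProcess {Ω : Type*} [MeasurableSpace Ω] (N : ℝ≥0 → Ω → ℕ) (R : ℝ≥0)
    (P : Measure Ω) : Prop where
  measurable : ∀ t, Measurable (N t)
  zero : ∀ᵐ ω ∂P, N 0 ω = 0
  indep : HasIndepIncrements N P
  law : ∀ s t : ℝ≥0, s ≤ t → HasLaw (fun ω => N t ω - N s ω) (poissonMeasure (R * (t - s))) P
  paths : ∀ᵐ ω ∂P, Monotone (fun t => N t ω) ∧
    ∀ t, ContinuousWithinAt (fun s => N s ω) (Ici t) t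

/-- The left limit `f(s-)` of a path. -/
def pathLeftLim (f : ℝ≥0 → ℝ) (s : ℝ≥0) : ℝ :=
  Function.leftLim f s

/-- The integral `∫₀ᵗ u dn` of a control against a counting path `n`: the sum, over the (finitely
many) jump times `s ∈ (0, t]` of `n`, of `u s` times the size of the jump. -/
def jumpIntegral (u : ℝ≥0 → Fin 2) (n : ℝ≥0 → ℕ) (t : ℝ≥0) : ℝ :=
  ∑ᶠ s ∈ Ioc 0 t, ((u s : ℕ) : ℝ) * ((n s : ℝ) - pathLeftLim (fun r => (n r : ℝ)) s)

/-- `Q` is the buffer size process with initial buffer size `D` when the free server delivers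
packets according to `N`, the costly one according to `Nc`, playback is at unit rate, and the
server is selected by the stationary Markov policy `π` (action `1`: both servers, action `0`: the
free server only):
`Q_t = D + N_t + ∫₀ᵗ u_s dNc_s - t`, where `u_s = π (Q_{s-})`, so that the packet that arrives at
time `s` is governed by the action chosen just before its arrival. -/
def IsBufferProcess {Ω : Type*} [MeasurableSpace Ω] (P : Measure Ω) (N Nc : ℝ≥0 → Ω → ℕ)
    (π : ℝ → Fin 2) (D : ℝ) (Q : ℝ≥0 → Ω → ℝ) : Prop :=
  ∀ᵐ ω ∂P, ∀ t : ℝ≥0,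
    Q t ω = D + (N t ω : ℝ)
      + jumpIntegral (fun s => π (pathLeftLim (fun r => Q r ω) s)) (fun s => Nc s ω) t - (t : ℝ)

open Classical in
/-- The online risky policy `π^T`: the costly server is used iff `0 < q < T`. The threshold `T = ∞`
is allowed. -/
def riskyPolicy (T : EReal) (q : ℝ) : Fin 2 :=
  if 0 < q ∧ (q : EReal) < T then 1 else 0

/-- The interruption time `τ₀ = inf {t : Q_t = 0}`, equal to `∞` if there is no such `t`. -/
def interruptionTime {Ω : Type*} (Q : ℝ≥0 → Ω → ℝ) (ω : Ω) : ℝ≥0∞ :=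
  ⨅ (t : ℝ≥0) (_ : Q t ω = 0), (t : ℝ≥0∞)

/-- The interruption probability `P (τ₀ < ∞)`. -/
def interruptionProb {Ω : Type*} [MeasurableSpace Ω] (P : Measure Ω) (Q : ℝ≥0 → Ω → ℝ) : ℝ :=
  P.real {ω | interruptionTime Q ω < ∞}

/-- The region `(1/α₁) log (1/ε) ≤ D ≤ (1/α₀) log (1/ε)`, with `ε > 0`. -/
def region (α₀ α₁ : ℝ) : Set (ℝ × ℝ) :=
  {p | 0 < p.2 ∧ 1 / α₁ * Real.log (1 / p.2) ≤ p.1 ∧ p.1 ≤ 1 / α₀ * Real.log (1 / p.2)}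

/-- `β = α₁ / (α₀ (1 - α₀/2))`. -/
def beta (α₀ α₁ : ℝ) : ℝ :=
  α₁ / (α₀ * (1 - α₀ / 2))

/-- `D̄ = (1/α₁) log (β/ε)`. -/
def breakpoint (α₀ α₁ ε : ℝ) : ℝ :=
  1 / α₁ * Real.log (beta α₀ α₁ / ε)

open Classical in
/-- The threshold `T*`. On the lower boundary `ε = e^{-α₁ D}` of the region, where the denominator
in the second formula vanishes, `T* = ∞`. -/
def riskyThreshold (α₀ α₁ D ε : ℝ) : EReal :=
  if breakpoint α₀ α₁ ε ≤ D then
    ((1 / (α₁ - α₀) * (Real.log (beta α₀ α₁ / ε) - α₀ * D) : ℝ) : EReal)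
  else if ε = Real.exp (-(α₁ * D)) then ⊤
  else
    ((1 / α₁ * Real.log ((ε + beta α₀ α₁ * (1 - Real.exp (-(α₁ * D))) - 1)
      / (ε - Real.exp (-(α₁ * D)))) : ℝ) : EReal)

end Streaming

end

/-!
The interruption probability is bounded by a supermartingale argument with an explicit function of
the buffer size. Below the threshold `t` take `U₁ q = a + (1 - a) e^{-α₁ q}`, from `t` on take
`U₀ q = v e^{-α₀ (q - t)}`, with `v = U₁ t` and `a` chosen such that `v / ((1 - a) e^{-α₁ t}) = β`
(`riskBound`). As `α₀` and `α₁` are roots of the exponent equations, `U₁` is harmonic when both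
servers are used and `U₀` when only the free one is. Since `β > α₁ / α₀`, the two functions cross
transversally at `t`: `U₀ ≤ U₁` above `t` and `U₁ ≤ U₀` just below it. Hence the combined function
is a supermartingale function for the threshold policy; it equals `1` at the empty buffer, and its
value at `D` bounds the risk. Comparing this value with `ε` gives the two formulas for the threshold
(`riskBound_le_of_lt_breakpoint`, `riskBound_le_of_breakpoint_le`).

No stochastic calculus is needed. The exponential functions are exactly harmonic over a time step of
any length `h`, so the supermartingale property holds without error for a discrete scheme
(`eulerBuffer`) that decides about the costly server only at the times `k h`
(`isSuperharmonicStep_riskBound`). The scheme depends on finitely many independent Poisson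
increments, so its law is under control although the buffer process is only given implicitly by its
path equation. The scheme is coupled with the buffer path by path
(`IsBufferPath.pos_of_lt_eulerBuffer`): as long as no grid interval contains two packets, the buffer
exceeds the scheme by a nonnegative integer, hence it is not empty before the scheme gets down to
`h`. Two packets in one of the `M` grid intervals have probability `O(M h²)`, which vanishes as the
grid is refined over a fixed time horizon (`interruptionProb_le_of_isSuperharmonicStep`).
-/

open Filter Topology

namespace Streaming

/-! ### Jump integrals against counting paths -/

/-- The size of the jump of the counting path `n` at time `s`. -/
noncomputable def jumpSize (n : ℝ≥0 → ℕ) (s : ℝ≥0) : ℝ :=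
  (n s : ℝ) - pathLeftLim (fun r => (n r : ℝ)) s

theorem monotone_natCast_path {n : ℝ≥0 → ℕ} (hn : Monotone n) :
    Monotone (fun r => (n r : ℝ)) :=
  fun _ _ h => Nat.cast_le.2 (hn h)

theorem jumpSize_nonneg {n : ℝ≥0 → ℕ} (hn : Monotone n) (s : ℝ≥0) : 0 ≤ jumpSize n s :=
  sub_nonneg.2 ((monotone_natCast_path hn).leftLim_le le_rfl)

theorem pathLeftLim_eq_of_tendsto {f : ℝ≥0 → ℝ} {s r : ℝ≥0} (hsr : s < r) {L : ℝ}
    (hf : Tendsto f (𝓝[<] r) (𝓝 L)) : pathLeftLim f r = L := by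
  have := nhdsLT_neBot_of_exists_lt ⟨s, hsr⟩
  exact leftLim_eq_of_tendsto hf

theorem jumpSize_eq_of_forall_Ico {n : ℝ≥0 → ℕ} {s r : ℝ≥0} (hsr : s < r)
    (h : ∀ x ∈ Ico s r, n x = n s) : jumpSize n r = (n r : ℝ) - n s := by
  unfold jumpSize
  rw [pathLeftLim_eq_of_tendsto hsr (L := (n s : ℝ))]
  refine tendsto_const_nhds.congr' ?_
  filter_upwards [Ico_mem_nhdsLT hsr] with x hx
  rw [h x hx]

/-- A nondecreasing counting path has finitely many jumps on a bounded interval: its values at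
distinct jump times are distinct integers. -/
theorem finite_Ioc_inter_support_jumpSize {n : ℝ≥0 → ℕ} (hn : Monotone n) (s t : ℝ≥0) :
    (Ioc s t ∩ Function.support (jumpSize n)).Finite := by
  refine Set.Finite.of_finite_image (f := n) ((finite_Iic (n t)).subset ?_) ?_
  · rintro _ ⟨r, ⟨hr, -⟩, rfl⟩
    exact hn hr.2
  · have key : ∀ r r' : ℝ≥0, r' ∈ Function.support (jumpSize n) → r < r' → n r < n r' := by
      intro r r' hr' hlt
      have h1 : (n r : ℝ) ≤ pathLeftLim (fun r => (n r : ℝ)) r' :=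
        (monotone_natCast_path hn).le_leftLim hlt
      have h2 : 0 < jumpSize n r' := lt_of_le_of_ne (jumpSize_nonneg hn r') (Ne.symm hr')
      unfold jumpSize at h2
      exact_mod_cast (by linarith : (n r : ℝ) < n r')
    intro r hr r' hr' heq
    rcases lt_trichotomy r r' with h | h | h
    · exact absurd heq (key r r' hr'.2 h).ne
    · exact h
    · exact absurd heq (key r' r hr.2 h).ne'

theorem jumpIntegral_eq_add {n : ℝ≥0 → ℕ} (hn : Monotone n) (u : ℝ≥0 → Fin 2) {s t : ℝ≥0}
    (hst : s ≤ t) : jumpIntegral u n t =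
      jumpIntegral u n s + ∑ᶠ r ∈ Ioc s t, ((u r : ℕ) : ℝ) * jumpSize n r := by
  have hfin : ∀ a b : ℝ≥0,
      (Ioc a b ∩ Function.support fun r => ((u r : ℕ) : ℝ) * jumpSize n r).Finite := fun a b =>
    (finite_Ioc_inter_support_jumpSize hn a b).subset
      (inter_subset_inter_right _ (Function.support_mul_subset_right _ _))
  have := finsum_mem_union' (Ioc_disjoint_Ioc_of_le (le_refl s)) (hfin 0 s) (hfin s t)
  rw [Ioc_union_Ioc_eq_Ioc zero_le hst] at this
  exact this

theorem jumpIntegral_mono {n : ℝ≥0 → ℕ} (hn : Monotone n) (u : ℝ≥0 → Fin 2) {s t : ℝ≥0}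
    (hst : s ≤ t) : jumpIntegral u n s ≤ jumpIntegral u n t := by
  rw [jumpIntegral_eq_add hn u hst]
  have : 0 ≤ ∑ᶠ r ∈ Ioc s t, ((u r : ℕ) : ℝ) * jumpSize n r :=
    finsum_nonneg fun r => finsum_nonneg fun _ =>
      mul_nonneg (Nat.cast_nonneg _) (jumpSize_nonneg hn r)
  linarith

theorem jumpIntegral_eq_of_eq {n : ℝ≥0 → ℕ} (hn : Monotone n) (u : ℝ≥0 → Fin 2) {s t : ℝ≥0}
    (hst : s ≤ t) (h : n t = n s) : jumpIntegral u n t = jumpIntegral u n s := by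
  rw [jumpIntegral_eq_add hn u hst, finsum_mem_eq_zero_of_forall_eq_zero, add_zero]
  intro r hr
  have hc : ∀ x, s ≤ x → x ≤ t → n x = n s := fun x h1 h2 =>
    le_antisymm ((hn h2).trans h.le) (hn h1)
  rw [jumpSize_eq_of_forall_Ico hr.1 (fun x hx => hc x hx.1 (hx.2.le.trans hr.2)),
    hc r hr.1.le hr.2, sub_self, mul_zero]

/-- If a counting path increases by exactly one over `[s, t]`, it does so at a single time `r`,
and the jump integral picks up exactly the control at `r`. -/
theorem exists_jumpIntegral_eq_add {n : ℝ≥0 → ℕ} (hn : Monotone n)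
    (hcont : ∀ t, ContinuousWithinAt n (Ici t) t) {s t : ℝ≥0} (hst : s ≤ t)
    (h : n t = n s + 1) :
    ∃ r ∈ Ioc s t, (∀ x ∈ Ico s r, n x = n s) ∧
      ∀ u, jumpIntegral u n t = jumpIntegral u n s + ((u r : ℕ) : ℝ) := by
  set A : Set ℝ≥0 := {x | n s + 1 ≤ n x} with hA
  have htA : t ∈ A := h.ge
  have hbdd : BddBelow A := OrderBot.bddBelow A
  set r := sInf A with hr
  have hlt : ∀ x < r, n x ≤ n s := fun x hx => by
    by_contra hcon
    exact absurd (csInf_le hbdd (show x ∈ A from Nat.succ_le_of_lt (not_le.1 hcon))) (not_le.2 hx)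
  have hgt : ∀ x, r < x → n s + 1 ≤ n x := fun x hx => by
    obtain ⟨y, hy, hyx⟩ := exists_lt_of_csInf_lt ⟨t, htA⟩ hx
    exact le_trans hy (hn hyx.le)
  -- right-continuity: the infimum of `A` is attained
  have hrA : n s + 1 ≤ n r := by
    have h1 : ∀ᶠ x in 𝓝[≥] r, n x = n r := by
      have := (hcont r).eventually (show ∀ᶠ m in 𝓝 (n r), m = n r by simp [nhds_discrete])
      exact this
    have h2 : ∀ᶠ x in 𝓝[>] r, n x = n r := h1.filter_mono (nhdsWithin_mono _ Ioi_subset_Ici_self)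
    obtain ⟨x, hx, hx'⟩ := (h2.and self_mem_nhdsWithin).exists
    exact hx ▸ hgt x hx'
  have hsr : s < r := by
    by_contra hcon
    exact absurd (hn (not_lt.1 hcon)) (by omega)
  have hrt : r ≤ t := csInf_le hbdd htA
  have hnr : n r = n s + 1 := le_antisymm ((hn hrt).trans h.le) hrA
  have hbefore : ∀ x ∈ Ico s r, n x = n s := fun x hx => le_antisymm (hlt x hx.2) (hn hx.1)
  refine ⟨r, ⟨hsr, hrt⟩, hbefore, fun u => ?_⟩
  have hone : jumpSize n r = 1 := by
    rw [jumpSize_eq_of_forall_Ico hsr hbefore, hnr]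
    push_cast
    ring
  have hzero : ∀ x ∈ Ioc s t, x ≠ r → ((u x : ℕ) : ℝ) * jumpSize n x = 0 := by
    intro x hx hne
    rcases lt_or_gt_of_ne hne with hxr | hxr
    · rw [jumpSize_eq_of_forall_Ico hx.1 fun y hy =>
        le_antisymm (hlt y (hy.2.trans hxr)) (hn hy.1),
        le_antisymm (hlt x hxr) (hn hx.1.le), sub_self, mul_zero]
    · have hc : ∀ y, r ≤ y → y ≤ t → n y = n r := fun y h1 h2 =>
        le_antisymm ((hn h2).trans (by omega)) (hn h1)
      rw [jumpSize_eq_of_forall_Ico hxr fun y hy => hc y hy.1 (hy.2.le.trans hx.2),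
        hc x hxr.le hx.2, sub_self, mul_zero]
  rw [jumpIntegral_eq_add hn u hst]
  congr 1
  calc ∑ᶠ x ∈ Ioc s t, ((u x : ℕ) : ℝ) * jumpSize n x
      = ∑ᶠ x ∈ ({r} : Set ℝ≥0), ((u x : ℕ) : ℝ) * jumpSize n x := by
        refine finsum_mem_inter_support_eq' _ _ _ fun x hx => ⟨fun hxs => ?_, fun hxr => ?_⟩
        · by_contra hne
          exact hx (hzero x hxs hne)
        · rw [mem_singleton_iff.1 hxr]
          exact ⟨hsr, hrt⟩
    _ = ((u r : ℕ) : ℝ) := by rw [finsum_mem_singleton, hone, mul_one]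

/-! ### The Euler scheme and its coupling with the buffer path -/

open Classical in
/-- The buffer size on a grid of mesh `h`, when `a k` free and `b k` costly packets are offered in
the `k`-th grid interval and the costly ones are taken iff the size at the left end of that
interval is below `T`. The scheme is frozen as soon as its value is at most `h`, the level from
which the buffer may run empty within one grid interval. -/
noncomputable def eulerBuffer (T : EReal) (h D : ℝ) (a b : ℕ → ℕ) : ℕ → ℝ
  | 0 => D
  | k + 1 => if eulerBuffer T h D a b k ≤ h then eulerBuffer T h D a b k else
      eulerBuffer T h D a b k - h + a k + if (eulerBuffer T h D a b k : EReal) < T then b k else 0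

theorem eulerBuffer_congr (T : EReal) (h D : ℝ) {a b a' b' : ℕ → ℕ} {k : ℕ}
    (ha : ∀ i < k, a i = a' i) (hb : ∀ i < k, b i = b' i) :
    eulerBuffer T h D a b k = eulerBuffer T h D a' b' k := by
  induction k with
  | zero => rfl
  | succ k ih =>
    simp only [eulerBuffer]
    rw [ih (fun i hi => ha i (hi.trans k.lt_succ_self))
        (fun i hi => hb i (hi.trans k.lt_succ_self)), ha k k.lt_succ_self, hb k k.lt_succ_self]

theorem lt_eulerBuffer_of_le {T : EReal} {h D : ℝ} {a b : ℕ → ℕ} {k m : ℕ} (hkm : k ≤ m)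
    (hm : h < eulerBuffer T h D a b m) : h < eulerBuffer T h D a b k := by
  induction m, hkm using Nat.le_induction with
  | base => exact hm
  | succ m _ ih =>
    refine ih ?_
    by_contra hcon
    rw [eulerBuffer, if_pos (not_lt.1 hcon)] at hm
    exact hcon hm

theorem eulerBuffer_pos {T : EReal} {h D : ℝ} (hD : 0 < D) (a b : ℕ → ℕ) (k : ℕ) :
    0 < eulerBuffer T h D a b k := by
  induction k with
  | zero => exact hD
  | succ k ih =>
    rw [eulerBuffer]
    split_ifs with h1 h2
    · exact ih
    · have := not_le.1 h1
      positivity [sub_pos.2 this]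
    · have := not_le.1 h1
      positivity [sub_pos.2 this]

/-- A deterministic version of `IsBufferProcess`: the path equation for one sample point. -/
def IsBufferPath (n c : ℝ≥0 → ℕ) (T : EReal) (D : ℝ) (q : ℝ≥0 → ℝ) : Prop :=
  ∀ t : ℝ≥0, q t = D + (n t : ℝ) + jumpIntegral (fun s => riskyPolicy T (pathLeftLim q s)) c t - t

section Path

variable {n c : ℝ≥0 → ℕ} {T : EReal} {D : ℝ} {q : ℝ≥0 → ℝ}

/-- The buffer drains at most at unit rate. -/
theorem IsBufferPath.sub_le (hq : IsBufferPath n c T D q) (hn : Monotone n) (hc : Monotone c)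
    {s t : ℝ≥0} (hst : s ≤ t) : q s - (t - s) ≤ q t := by
  have h1 := jumpIntegral_mono hc (fun s => riskyPolicy T (pathLeftLim q s)) hst
  have h2 : (n s : ℝ) ≤ n t := Nat.cast_le.2 (hn hst)
  rw [hq t, hq s]
  linarith

/-- One grid interval of the coupling: if at most one packet is offered and the buffer exceeds the
Euler scheme by a nonnegative integer, it still does so at the end of the interval. The scheme can
take a costly packet that the buffer refuses only if the buffer is strictly ahead: if both agree at
`y`, with `h < y < T`, the buffer stays in `(0, T)` until that packet arrives. -/
theorem IsBufferPath.exists_eq_step_add (hq : IsBufferPath n c T D q) (hn : Monotone n)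
    (hc : Monotone c) (hcont : ∀ t, ContinuousWithinAt c (Ici t) t) {s t : ℝ≥0} (hst : s ≤ t)
    (hle : n t - n s + (c t - c s) ≤ 1) {y : ℝ} (hy : (t : ℝ) - s < y) {m : ℕ}
    (hm : q s = y + m) :
    ∃ m' : ℕ, q t = (y - (t - s) + ((n t - n s : ℕ) : ℝ) +
      ((if (y : EReal) < T then c t - c s else 0 : ℕ) : ℝ)) + m' := by
  have hns := hn hst
  have hcs := hc hst
  have hncast : ((n t - n s : ℕ) : ℝ) = n t - n s := Nat.cast_sub hns
  have hqt := hq t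
  have hqs := hq s
  rcases hcs.eq_or_lt with heq | hlt
  · refine ⟨m, ?_⟩
    rw [jumpIntegral_eq_of_eq hc _ hst heq.symm] at hqt
    simp only [heq, Nat.sub_self, ite_self, Nat.cast_zero]
    linarith
  · have hct : c t = c s + 1 := by omega
    have hnt : n t = n s := by omega
    obtain ⟨r, hr, hbefore, hJ⟩ := exists_jumpIntegral_eq_add hc hcont hst hct
    rw [hJ] at hqt
    have hone : c t - c s = 1 := by omega
    rw [hone, hncast, hnt]
    rw [hnt] at hqt
    by_cases hyT : (y : EReal) < T
    · rw [if_pos hyT]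
      cases m with
      | succ m =>
        refine ⟨m + (riskyPolicy T (pathLeftLim q r) : ℕ), ?_⟩
        push_cast at hm ⊢
        linarith
      | zero =>
        have hleft : pathLeftLim q r = q s - (r - s) := by
          refine pathLeftLim_eq_of_tendsto hr.1 ?_
          have hlim : Tendsto (fun x : ℝ≥0 => q s - ((x : ℝ) - s)) (𝓝[<] r)
              (𝓝 (q s - (r - s))) := by
            refine (Continuous.tendsto ?_ r).mono_left nhdsWithin_le_nhds
            fun_prop
          refine hlim.congr' ?_
          filter_upwards [Ico_mem_nhdsLT hr.1] with x hx
          have hnx : n x = n s :=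
            le_antisymm ((hn (hx.2.le.trans hr.2)).trans hnt.le) (hn hx.1)
          rw [hq x, hqs, hnx, jumpIntegral_eq_of_eq hc _ hx.1 (hbefore x hx)]
          ring
        have hpol : riskyPolicy T (pathLeftLim q r) = 1 := by
          have hrs : (s : ℝ) < r := hr.1
          have hrt : (r : ℝ) ≤ t := hr.2
          rw [hleft, hm, riskyPolicy, if_pos]
          push_cast
          refine ⟨by linarith, lt_of_le_of_lt ?_ hyT⟩
          exact_mod_cast (by linarith : y + 0 - (r - s) ≤ y)
        refine ⟨0, ?_⟩
        rw [hpol] at hqt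
        push_cast at hm hqt ⊢
        simp at hqt
        linarith
    · rw [if_neg hyT]
      refine ⟨m + (riskyPolicy T (pathLeftLim q r) : ℕ), ?_⟩
      push_cast
      linarith

/-- The coupling: if at most one packet is offered in each of the first `M` grid intervals and the
Euler scheme is not frozen by then, the buffer does not run empty up to time `M h`. -/
theorem IsBufferPath.pos_of_lt_eulerBuffer (hq : IsBufferPath n c T D q) (hn : Monotone n)
    (hc : Monotone c) (hcont : ∀ t, ContinuousWithinAt c (Ici t) t) (hn0 : n 0 = 0) {h : ℝ≥0}
    (hh : 0 < h) {M : ℕ}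
    (hle : ∀ k < M, n ((k + 1 : ℕ) * h) - n (k * h) + (c ((k + 1 : ℕ) * h) - c (k * h)) ≤ 1)
    (hM : h < eulerBuffer T h D (fun k => n ((k + 1 : ℕ) * h) - n (k * h))
      (fun k => c ((k + 1 : ℕ) * h) - c (k * h)) M) {t : ℝ≥0} (ht : t ≤ M * h) :
    0 < q t := by
  set Y := eulerBuffer T h D (fun k => n ((k + 1 : ℕ) * h) - n (k * h))
      (fun k => c ((k + 1 : ℕ) * h) - c (k * h)) with hY
  have key : ∀ k ≤ M, ∃ m : ℕ, q (k * h) = Y k + m := by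
    intro k
    induction k with
    | zero =>
      intro _
      refine ⟨0, ?_⟩
      have := hq 0
      simp [hn0, jumpIntegral] at this
      simp [hY, eulerBuffer, this]
    | succ k ih =>
      intro hk
      obtain ⟨m, hm⟩ := ih (by omega)
      have hYk : (h : ℝ) < Y k := lt_eulerBuffer_of_le (by omega) hM
      have hlen : (((k + 1 : ℕ) * h : ℝ≥0) : ℝ) - (k * h : ℝ≥0) = h := by
        push_cast
        ring
      obtain ⟨m', hm'⟩ := hq.exists_eq_step_add hn hc hcont
        (mul_le_mul_left (Nat.cast_le.2 k.le_succ) h) (hle k (by omega))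
        (by rw [hlen]; exact hYk) hm
      refine ⟨m', hm'.trans ?_⟩
      rw [hlen, hY, eulerBuffer, if_neg (not_le.2 hYk), ← hY]
  -- `t` is less than `h` after the grid point `k h`, where the buffer exceeds `h`
  set k := ⌊t / h⌋₊ with hk
  have hkt : (k : ℝ≥0) * h ≤ t := by
    rw [← le_div_iff₀ hh]
    exact Nat.floor_le zero_le
  have htk : t < (k + 1) * h := by
    rw [← div_lt_iff₀ hh]
    exact Nat.lt_floor_add_one _
  have hkM : k ≤ M := by
    have h1 : (k : ℝ≥0) ≤ M := by
      rw [← mul_le_mul_iff_left₀ hh]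
      exact hkt.trans ht
    exact_mod_cast h1
  obtain ⟨m, hm⟩ := key k hkM
  have hYk : (h : ℝ) < Y k := lt_eulerBuffer_of_le hkM hM
  have h1 := hq.sub_le hn hc hkt
  have h2 : (t : ℝ) < (k + 1) * h := by exact_mod_cast htk
  have h3 : (0 : ℝ) ≤ m := m.cast_nonneg
  push_cast at h1
  linarith

end Path

/-! ### Poisson integrals -/

/-- The Laplace transform of the Poisson distribution. -/
theorem lintegral_exp_poissonMeasure (r : ℝ≥0) {c : ℝ} (hc : 0 ≤ c) (α : ℝ) :
    ∫⁻ n : ℕ, ENNReal.ofReal (c * Real.exp (-(α * n))) ∂poissonMeasure r =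
      ENNReal.ofReal (c * Real.exp (r * (Real.exp (-α) - 1))) := by
  rw [poissonMeasure, lintegral_sum_measure]
  simp only [lintegral_smul_measure, lintegral_dirac, smul_eq_mul]
  have hs : HasSum (fun n : ℕ => Real.exp (-r) * (r : ℝ) ^ n / n.factorial *
      (c * Real.exp (-(α * n)))) (c * Real.exp (r * (Real.exp (-α) - 1))) := by
    have h1 := ((NormedSpace.expSeries_div_hasSum_exp ((r : ℝ) * Real.exp (-α))).mul_left
      (c * Real.exp (-r)))
    rw [← Real.exp_eq_exp_ℝ] at h1
    convert! h1 using 1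
    · ext n
      rw [mul_pow, ← Real.exp_nat_mul]
      ring_nf
    · rw [mul_assoc, ← Real.exp_add]
      ring_nf
  rw [← hs.tsum_eq, ENNReal.ofReal_tsum_of_nonneg (fun n => by positivity) hs.summable]
  refine tsum_congr fun n => ?_
  rw [ENNReal.ofReal_mul (p := Real.exp (-r) * (r : ℝ) ^ n / n.factorial) (by positivity)]

theorem poissonMeasure_setOf_two_le_le (r : ℝ≥0) :
    poissonMeasure r {n | 2 ≤ n} ≤ ENNReal.ofReal ((r : ℝ) ^ 2) := by
  have hcompl : {n : ℕ | 2 ≤ n} = ({0, 1} : Set ℕ)ᶜ := by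
    ext n
    simp
    omega
  have hreal : (poissonMeasure r).real {0, 1} = Real.exp (-r) * (1 + r) := by
    rw [show ({0, 1} : Set ℕ) = {0} ∪ {1} from rfl,
      measureReal_union (by simp) (measurableSet_singleton _),
      poissonMeasure_real_singleton, poissonMeasure_real_singleton]
    simp
    ring
  rw [← ofReal_measureReal, hcompl, probReal_compl_eq_one_sub (by simp), hreal]
  refine ENNReal.ofReal_le_ofReal ?_
  nlinarith [Real.add_one_le_exp (-(r : ℝ)), r.coe_nonneg]

/-! ### One step of the Euler scheme -/

theorem IsPoissonProcess.indepFun_past {Ω : Type*} [MeasurableSpace Ω] {P : Measure Ω}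
    {N : ℝ≥0 → Ω → ℕ} {R : ℝ≥0}
    (hN : IsPoissonProcess N R P)
    (h : ℝ≥0) (k : ℕ) :
    IndepFun (fun ω (i : Finset.range k) => N ((i + 1 : ℕ) * h) ω - N (i * h) ω)
      (fun ω => N ((k + 1 : ℕ) * h) ω - N (k * h) ω) P := by
  have hmono : Monotone (fun k : ℕ => (k : ℝ≥0) * h) := fun a b hab =>
    mul_le_mul_left (Nat.cast_le.2 hab) h
  have := (hN.indep.nat hmono).indepFun_finset (Finset.range k) {k} (by simp)
    (fun i => (hN.measurable _).sub (hN.measurable _))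
  exact this.comp (φ := id) (ψ := fun f : ({k} : Finset ℕ) → ℕ => f ⟨k, by simp⟩) measurable_id
    (measurable_pi_apply _)

theorem IsPoissonProcess.hasLaw_grid {Ω : Type*} [MeasurableSpace Ω] {P : Measure Ω}
    {N : ℝ≥0 → Ω → ℕ} {R : ℝ≥0}
    (hN : IsPoissonProcess N R P)
    (h : ℝ≥0) (k : ℕ) :
    HasLaw (fun ω => N ((k + 1 : ℕ) * h) ω - N (k * h) ω) (poissonMeasure (R * h)) P := by
  have := hN.law (k * h) ((k + 1 : ℕ) * h) (mul_le_mul_left (Nat.cast_le.2 k.le_succ) h)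
  have hlen : ((k + 1 : ℕ) : ℝ≥0) * h - k * h = h := by
    rw [← tsub_mul, Nat.cast_succ, add_tsub_cancel_left, one_mul]
  rwa [hlen] at this

theorem measure_two_le_increments_le {Ω : Type*} [MeasurableSpace Ω] {P : Measure Ω}
    {N Nc : ℝ≥0 → Ω → ℕ} {R₀ Rc : ℝ≥0} (hN : IsPoissonProcess N R₀ P)
    (hNc : IsPoissonProcess Nc Rc P)
    (hindep : IndepFun (fun ω t => N t ω) (fun ω t => Nc t ω) P) (h : ℝ≥0) (k : ℕ) :
    P {ω | 2 ≤ N ((k + 1 : ℕ) * h) ω - N (k * h) ω +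
      (Nc ((k + 1 : ℕ) * h) ω - Nc (k * h) ω)} ≤ ENNReal.ofReal (((R₀ + Rc) * h : ℝ) ^ 2) := by
  have hi : IndepFun (fun ω => N ((k + 1 : ℕ) * h) ω - N (k * h) ω)
      (fun ω => Nc ((k + 1 : ℕ) * h) ω - Nc (k * h) ω) P :=
    hindep.comp (φ := fun n : ℝ≥0 → ℕ => n ((k + 1 : ℕ) * h) - n (k * h))
      (ψ := fun n : ℝ≥0 → ℕ => n ((k + 1 : ℕ) * h) - n (k * h)) (by fun_prop) (by fun_prop)
  have hlaw := hi.hasLaw_add_poissonMeasure (hN.hasLaw_grid h k) (hNc.hasLaw_grid h k)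
  have := hlaw.measure_eq (p := fun m => 2 ≤ m) (by measurability)
  simp only [Pi.add_apply] at this
  rw [this]
  refine (poissonMeasure_setOf_two_le_le _).trans (le_of_eq ?_)
  push_cast
  ring_nf

section Independence

variable {Ω : Type*} [MeasurableSpace Ω] {P : Measure Ω} [IsProbabilityMeasure P]

/-- Two independent pairs `(A, a)`, `(B, b)`, each with independent components: integrate out `a`
and `b` first. -/
theorem lintegral_eq_of_indepFun_pairs {α β : Type*} [MeasurableSpace α] [MeasurableSpace β]
    [Countable α] [MeasurableSingletonClass α] [Countable β] [MeasurableSingletonClass β]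
    {A : Ω → α} {B : Ω → β} {a b : Ω → ℕ} (hA : Measurable A) (hB : Measurable B)
    (ha : Measurable a) (hb : Measurable b) (hAa : IndepFun A a P) (hBb : IndepFun B b P)
    (hAB : IndepFun (fun ω => (A ω, a ω)) (fun ω => (B ω, b ω)) P)
    (F : α → β → ℕ → ℕ → ℝ≥0∞) :
    ∫⁻ ω, F (A ω) (B ω) (a ω) (b ω) ∂P =
      ∫⁻ ω, ∫⁻ i, ∫⁻ j, F (A ω) (B ω) i j ∂(P.map b) ∂(P.map a) ∂P := by
  have := Measure.isProbabilityMeasure_map (μ := P) hA.aemeasurable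
  have := Measure.isProbabilityMeasure_map (μ := P) hB.aemeasurable
  have := Measure.isProbabilityMeasure_map (μ := P) ha.aemeasurable
  have := Measure.isProbabilityMeasure_map (μ := P) hb.aemeasurable
  have hAB' : IndepFun A B P := hAB.comp measurable_fst measurable_fst
  have hFm : Measurable (fun p : (α × ℕ) × (β × ℕ) => F p.1.1 p.2.1 p.1.2 p.2.2) :=
    Measurable.of_discrete
  calc ∫⁻ ω, F (A ω) (B ω) (a ω) (b ω) ∂P
      = ∫⁻ p, F p.1.1 p.2.1 p.1.2 p.2.2
          ∂(P.map fun ω => ((A ω, a ω), (B ω, b ω))) :=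
        (lintegral_map hFm ((hA.prodMk ha).prodMk (hB.prodMk hb))).symm
    _ = ∫⁻ x, ∫⁻ i, ∫⁻ y, ∫⁻ j, F x y i j ∂(P.map b) ∂(P.map B) ∂(P.map a) ∂(P.map A) := by
        rw [hAB.map_prod_eq_prod_map_map (hA.prodMk ha).aemeasurable (hB.prodMk hb).aemeasurable,
          hAa.map_prod_eq_prod_map_map hA.aemeasurable ha.aemeasurable,
          hBb.map_prod_eq_prod_map_map hB.aemeasurable hb.aemeasurable,
          lintegral_prod _ hFm.aemeasurable,
          lintegral_prod _ hFm.lintegral_prod_right'.aemeasurable]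
        refine lintegral_congr fun x => lintegral_congr fun i => ?_
        exact lintegral_prod _ (hFm.comp measurable_prodMk_left).aemeasurable
    _ = ∫⁻ x, ∫⁻ y, ∫⁻ i, ∫⁻ j, F x y i j ∂(P.map b) ∂(P.map a) ∂(P.map B) ∂(P.map A) := by
        refine lintegral_congr fun x => ?_
        rw [lintegral_lintegral_swap]
        have : Measurable (fun p : (ℕ × β) × ℕ => F x p.1.2 p.1.1 p.2) :=
          hFm.comp (g := fun p : (α × ℕ) × (β × ℕ) => F p.1.1 p.2.1 p.1.2 p.2.2)
            (f := fun p : (ℕ × β) × ℕ => ((x, p.1.1), (p.1.2, p.2))) (by fun_prop)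
        exact (this.lintegral_prod_right' (ν := P.map b)).aemeasurable
    _ = ∫⁻ p, ∫⁻ i, ∫⁻ j, F p.1 p.2 i j ∂(P.map b) ∂(P.map a)
          ∂(P.map fun ω => (A ω, B ω)) := by
        rw [hAB'.map_prod_eq_prod_map_map hA.aemeasurable hB.aemeasurable,
          lintegral_prod _ (Measurable.of_discrete).aemeasurable]
    _ = _ := lintegral_map Measurable.of_discrete (hA.prodMk hB)

/-- `V` is a supermartingale function of the Euler scheme: from a state above `h`, the mean of `V`
after one step is at most its present value. -/
def IsSuperharmonicStep (R₀ Rc : ℝ≥0) (T : EReal) (V : ℝ → ℝ) (h : ℝ≥0) : Prop :=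
  ∀ y : ℝ, (h : ℝ) < y → ∫⁻ i : ℕ, ∫⁻ j : ℕ,
    ENNReal.ofReal (V (y - h + i + ((if (y : EReal) < T then j else 0 : ℕ) : ℝ)))
      ∂poissonMeasure (Rc * h) ∂poissonMeasure (R₀ * h) ≤ ENNReal.ofReal (V y)

variable {N Nc : ℝ≥0 → Ω → ℕ} {R₀ Rc : ℝ≥0}

/-- The Euler scheme driven by the increments of `N` and `Nc` over the grid of mesh `h`. -/
noncomputable def gridBuffer (N Nc : ℝ≥0 → Ω → ℕ) (T : EReal) (h : ℝ≥0) (D : ℝ) (k : ℕ)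
    (ω : Ω) : ℝ :=
  eulerBuffer T h D (fun k => N ((k + 1 : ℕ) * h) ω - N (k * h) ω)
    (fun k => Nc ((k + 1 : ℕ) * h) ω - Nc (k * h) ω) k

/-- The increments over the next grid interval are independent of the scheme so far, so a
superharmonic function of the scheme has decreasing means. -/
theorem lintegral_gridBuffer_succ_le (hN : IsPoissonProcess N R₀ P)
    (hNc : IsPoissonProcess Nc Rc P)
    (hindep : IndepFun (fun ω t => N t ω) (fun ω t => Nc t ω) P) {T : EReal} {V : ℝ → ℝ}
    {h : ℝ≥0} (hV : IsSuperharmonicStep R₀ Rc T V h) (D : ℝ) (k : ℕ) :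
    ∫⁻ ω, ENNReal.ofReal (V (gridBuffer N Nc T h D (k + 1) ω)) ∂P ≤
      ∫⁻ ω, ENNReal.ofReal (V (gridBuffer N Nc T h D k ω)) ∂P := by
  set a : ℕ → Ω → ℕ := fun k ω => N ((k + 1 : ℕ) * h) ω - N (k * h) ω with ha
  set b : ℕ → Ω → ℕ := fun k ω => Nc ((k + 1 : ℕ) * h) ω - Nc (k * h) ω with hb
  have ham : ∀ k, Measurable (a k) := fun k => (hN.measurable _).sub (hN.measurable _)
  have hbm : ∀ k, Measurable (b k) := fun k => (hNc.measurable _).sub (hNc.measurable _)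
  let A : Ω → (Finset.range k → ℕ) := fun ω i => a i ω
  let B : Ω → (Finset.range k → ℕ) := fun ω i => b i ω
  have hA : Measurable A := measurable_pi_lambda _ fun i => ham i
  have hB : Measurable B := measurable_pi_lambda _ fun i => hbm i
  -- the scheme after `k` steps is a function `Y` of the first `k` increments
  let ext : (Finset.range k → ℕ) → ℕ → ℕ := fun f i =>
    if hi : i ∈ Finset.range k then f ⟨i, hi⟩ else 0
  let Y : (Finset.range k → ℕ) → (Finset.range k → ℕ) → ℝ := fun f g =>
    eulerBuffer T h D (ext f) (ext g) k
  have hY : ∀ ω, gridBuffer N Nc T h D k ω = Y (A ω) (B ω) := fun ω =>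
    eulerBuffer_congr T h D (fun i hi => by simp [ext, A, a, hi])
      (fun i hi => by simp [ext, B, b, hi])
  let F : (Finset.range k → ℕ) → (Finset.range k → ℕ) → ℕ → ℕ → ℝ≥0∞ := fun f g i j =>
    ENNReal.ofReal (V (if Y f g ≤ h then Y f g else
      Y f g - h + i + ((if (Y f g : EReal) < T then j else 0 : ℕ) : ℝ)))
  have hF : ∀ ω, ENNReal.ofReal (V (gridBuffer N Nc T h D (k + 1) ω)) =
      F (A ω) (B ω) (a k ω) (b k ω) := by
    intro ω
    simp only [F, ← hY]
    rfl
  have hAB : IndepFun (fun ω => (A ω, a k ω)) (fun ω => (B ω, b k ω)) P := by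
    refine hindep.comp
      (φ := fun n : ℝ≥0 → ℕ => ((fun i : Finset.range k => n ((i + 1 : ℕ) * h) - n (i * h)),
        n ((k + 1 : ℕ) * h) - n (k * h)))
      (ψ := fun n : ℝ≥0 → ℕ => ((fun i : Finset.range k => n ((i + 1 : ℕ) * h) - n (i * h)),
        n ((k + 1 : ℕ) * h) - n (k * h))) ?_ ?_ <;> fun_prop
  simp_rw [hF]
  rw [lintegral_eq_of_indepFun_pairs hA hB (ham k) (hbm k) (hN.indepFun_past h k)
    (hNc.indepFun_past h k) hAB F]
  refine lintegral_mono fun ω => ?_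
  rw [(hN.hasLaw_grid h k).map_eq, (hNc.hasLaw_grid h k).map_eq]
  simp only [hY, F]
  split_ifs with hle hT
  · simp
  · have := hV _ (not_le.1 hle)
    simpa only [if_pos hT] using this
  · have := hV _ (not_le.1 hle)
    simpa only [if_neg hT] using this

theorem measurable_gridBuffer (hN : ∀ t, Measurable (N t)) (hNc : ∀ t, Measurable (Nc t))
    (T : EReal) (h : ℝ≥0) (D : ℝ) (k : ℕ) : Measurable (gridBuffer N Nc T h D k) := by
  induction k with
  | zero => exact measurable_const
  | succ k ih =>
    have : gridBuffer N Nc T h D (k + 1) = fun ω =>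
        if gridBuffer N Nc T h D k ω ≤ h then gridBuffer N Nc T h D k ω else
        gridBuffer N Nc T h D k ω - h + ((N ((k + 1 : ℕ) * h) ω - N (k * h) ω : ℕ) : ℝ) +
          if (gridBuffer N Nc T h D k ω : EReal) < T then
            ((Nc ((k + 1 : ℕ) * h) ω - Nc (k * h) ω : ℕ) : ℝ) else 0 := by
      ext ω
      simp only [gridBuffer]
      rw [eulerBuffer]
      push_cast
      rfl
    rw [this]
    have hinc : ∀ {n : ℝ≥0 → Ω → ℕ}, (∀ t, Measurable (n t)) →
        Measurable fun ω => ((n ((k + 1 : ℕ) * h) ω - n (k * h) ω : ℕ) : ℝ) := fun hn =>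
      measurable_from_top.comp ((hn _).sub (hn _))
    refine Measurable.ite (measurableSet_le ih measurable_const) ih
      (((ih.sub measurable_const).add (hinc hN)).add
        (Measurable.ite (measurableSet_lt ?_ measurable_const) (hinc hNc) measurable_const))
    exact measurable_coe_real_ereal.comp ih

/-! ### From superharmonic functions to the interruption probability -/

/-- On a grid of mesh `h`, emptiness before time `M h` forces either the Euler scheme to be frozen
or two packets to be offered in one grid interval. -/
theorem measureReal_exists_eq_zero_mul_le (hN : IsPoissonProcess N R₀ P)
    (hNc : IsPoissonProcess Nc Rc P)
    (hindep : IndepFun (fun ω t => N t ω) (fun ω t => Nc t ω) P) {T : EReal} {D : ℝ}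
    (hD : 0 < D) {Q : ℝ≥0 → Ω → ℝ} (hQ : IsBufferProcess P N Nc (riskyPolicy T) D Q)
    {V : ℝ → ℝ} (hVD : 0 ≤ V D) {h : ℝ≥0} (hh : 0 < h) (hVh : 0 ≤ V h)
    (hV : IsSuperharmonicStep R₀ Rc T V h) (hmin : ∀ y : ℝ, 0 < y → y ≤ h → V h ≤ V y) (M : ℕ) :
    P.real {ω | ∃ t : ℝ≥0, t ≤ M * h ∧ Q t ω = 0} * V h ≤
      V D + M * ((R₀ + Rc) * h : ℝ) ^ 2 * V h := by
  set Z := {ω | ∃ t : ℝ≥0, t ≤ M * h ∧ Q t ω = 0} with hZ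
  set S := {ω | gridBuffer N Nc T h D M ω ≤ h} with hS
  set B : ℕ → Set Ω := fun k => {ω | 2 ≤ N ((k + 1 : ℕ) * h) ω - N (k * h) ω +
      (Nc ((k + 1 : ℕ) * h) ω - Nc (k * h) ω)} with hB
  have hSm : MeasurableSet S :=
    measurableSet_le (measurable_gridBuffer hN.measurable hNc.measurable T h D M) measurable_const
  -- `Z` need not be measurable: it is only bounded from above, by measurable events
  have hsub : Z ≤ᵐ[P] (S ∪ ⋃ k ∈ Finset.range M, B k : Set Ω) := by
    filter_upwards [hQ, hN.zero, hN.paths, hNc.paths] with ω hq h0 hn hc hz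
    obtain ⟨t, ht, hzero⟩ := hz
    by_contra hcon
    have h1 : ω ∉ S := fun h => hcon (Or.inl h)
    have h2 : ∀ k < M, ω ∉ B k := fun k hk h =>
      hcon (Or.inr (mem_biUnion (Finset.mem_coe.2 (Finset.mem_range.2 hk)) h))
    have hpath : IsBufferPath (fun s => N s ω) (fun s => Nc s ω) T D (fun s => Q s ω) := hq
    have := hpath.pos_of_lt_eulerBuffer hn.1 hc.1 hc.2 h0 hh (M := M)
      (fun k hk => by have := h2 k hk; simp only [hB, mem_ofPred_eq] at this; omega)
      (not_le.1 h1) ht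
    exact this.ne' hzero
  have hBk : ∀ k, P.real (B k) ≤ ((R₀ + Rc) * h : ℝ) ^ 2 := fun k =>
    ENNReal.toReal_le_of_le_ofReal (by positivity)
      (measure_two_le_increments_le hN hNc hindep h k)
  have hPZ : P.real Z ≤ P.real S + M * ((R₀ + Rc) * h : ℝ) ^ 2 := by
    calc P.real Z ≤ P.real (S ∪ ⋃ k ∈ Finset.range M, B k) :=
          ENNReal.toReal_mono (measure_ne_top _ _) (measure_mono_ae hsub)
      _ ≤ P.real S + P.real (⋃ k ∈ Finset.range M, B k) := measureReal_union_le _ _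
      _ ≤ P.real S + ∑ k ∈ Finset.range M, P.real (B k) := by
          gcongr
          exact measureReal_biUnion_finset_le _ _
      _ ≤ P.real S + ∑ k ∈ Finset.range M, ((R₀ + Rc) * h : ℝ) ^ 2 := by
          gcongr with k
          exact hBk k
      _ = _ := by simp
  have hint : ∀ k, ∫⁻ ω, ENNReal.ofReal (V (gridBuffer N Nc T h D k ω)) ∂P ≤
      ENNReal.ofReal (V D) := by
    intro k
    induction k with
    | zero => simp [gridBuffer, eulerBuffer]
    | succ k ih => exact (lintegral_gridBuffer_succ_le hN hNc hindep hV D k).trans ih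
  have hPS : P.real S * V h ≤ V D := by
    -- Markov's inequality; the Euler scheme stays positive, hence lies in `(0, h]` on `S`
    have h1 : ENNReal.ofReal (V h) * P S ≤ ENNReal.ofReal (V D) := by
      rw [← lintegral_indicator_const hSm]
      refine (lintegral_mono fun ω => ?_).trans (hint M)
      by_cases hω : ω ∈ S
      · rw [indicator_of_mem hω]
        exact ENNReal.ofReal_le_ofReal (hmin _ (eulerBuffer_pos hD _ _ _) hω)
      · rw [indicator_of_notMem hω]
        exact zero_le
    have h2 := ENNReal.toReal_mono ENNReal.ofReal_ne_top h1
    rwa [ENNReal.toReal_mul, ENNReal.toReal_ofReal hVh, ENNReal.toReal_ofReal hVD, mul_comm] at h2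
  nlinarith [mul_le_mul_of_nonneg_right hPZ hVh]

/-- If `V` is superharmonic for all small meshes and tends to `1` at the empty buffer, then `V D`
bounds the probability of ever running empty. -/
theorem interruptionProb_le_of_isSuperharmonicStep (hN : IsPoissonProcess N R₀ P)
    (hNc : IsPoissonProcess Nc Rc P)
    (hindep : IndepFun (fun ω t => N t ω) (fun ω t => Nc t ω) P) {T : EReal} {D : ℝ}
    (hD : 0 < D) {Q : ℝ≥0 → Ω → ℝ} (hQ : IsBufferProcess P N Nc (riskyPolicy T) D Q)
    {V : ℝ → ℝ} (hVD : 0 ≤ V D) (hV0 : Tendsto V (𝓝[>] 0) (𝓝 1))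
    (hV : ∀ᶠ h : ℝ≥0 in 𝓝[>] 0, IsSuperharmonicStep R₀ Rc T V h ∧
      ∀ y : ℝ, 0 < y → y ≤ h → V h ≤ V y) :
    interruptionProb P Q ≤ V D := by
  have hfix : ∀ m : ℕ, 0 < m → P {ω | ∃ t : ℝ≥0, t ≤ m ∧ Q t ω = 0} ≤ ENNReal.ofReal (V D) := by
    intro m hm
    rw [← ofReal_measureReal]
    refine ENNReal.ofReal_le_ofReal ?_
    set p := P.real {ω | ∃ t : ℝ≥0, t ≤ m ∧ Q t ω = 0} with hp
    -- refine the grid on `[0, m]`: the error term is `n h² = m h`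
    let h : ℕ → ℝ≥0 := fun n => m / (n + 1 : ℕ)
    have hpos : ∀ n, 0 < h n := fun n => by positivity
    have hlim : Tendsto h atTop (𝓝[>] 0) := by
      refine tendsto_nhdsWithin_iff.2 ⟨?_, Eventually.of_forall hpos⟩
      have := (tendsto_const_div_atTop_nhds_zero_nat (m : ℝ≥0)).comp (tendsto_add_atTop_nat 1)
      exact this
    have hlimR : Tendsto (fun n => ((h n : ℝ≥0) : ℝ)) atTop (𝓝[>] 0) := by
      refine tendsto_nhdsWithin_iff.2 ⟨?_, Eventually.of_forall hpos⟩
      exact (NNReal.continuous_coe.tendsto 0).comp (hlim.mono_right nhdsWithin_le_nhds)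
    have hVlim : Tendsto (fun n => V (h n)) atTop (𝓝 1) := hV0.comp hlimR
    have hev : ∀ᶠ n in atTop, p * V (h n) ≤
        V D + m * (R₀ + Rc : ℝ) ^ 2 * h n * V (h n) := by
      filter_upwards [hlim.eventually hV, hVlim.eventually (lt_mem_nhds one_pos)] with n hn hpos'
      have := measureReal_exists_eq_zero_mul_le hN hNc hindep hD hQ hVD (hpos n) hpos'.le hn.1 hn.2
        (n + 1)
      have hmul : ((n + 1 : ℕ) : ℝ≥0) * h n = m := by
        simp only [h]
        field_simp
      have hmulR : ((n + 1 : ℕ) : ℝ) * h n = m := by exact_mod_cast congrArg NNReal.toReal hmul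
      rw [hmul] at this
      refine this.trans (le_of_eq ?_)
      rw [← hmulR]
      ring
    have hR : Tendsto (fun n => V D + m * (R₀ + Rc : ℝ) ^ 2 * h n * V (h n)) atTop
        (𝓝 (V D + m * (R₀ + Rc : ℝ) ^ 2 * 0 * 1)) :=
      tendsto_const_nhds.add ((tendsto_const_nhds.mul
        (hlimR.mono_right nhdsWithin_le_nhds)).mul hVlim)
    have := le_of_tendsto_of_tendsto (tendsto_const_nhds.mul hVlim) hR hev
    simpa using this
  have hunion : {ω | interruptionTime Q ω < ∞} ⊆
      ⋃ m : ℕ, {ω | ∃ t : ℝ≥0, t ≤ (m + 1 : ℕ) ∧ Q t ω = 0} := by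
    intro ω hω
    simp only [mem_ofPred_eq, interruptionTime, iInf_lt_iff] at hω
    obtain ⟨t, ht, -⟩ := hω
    obtain ⟨m, hm⟩ := exists_nat_ge t
    exact mem_iUnion.2 ⟨m, t, hm.trans (Nat.cast_le.2 m.le_succ), ht⟩
  refine ENNReal.toReal_le_of_le_ofReal hVD ((measure_mono hunion).trans ?_)
  rw [Directed.measure_iUnion]
  · exact iSup_le fun m => hfix (m + 1) m.succ_pos
  · refine Monotone.directed_le fun m m' hmm ω ⟨t, ht, hz⟩ => ⟨t, ht.trans ?_, hz⟩
    exact Nat.cast_le.2 (Nat.succ_le_succ hmm)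

end Independence

/-! ### The exponent -/

theorem exponent_add_eq_zero {R : ℝ} (hR : 0 ≤ R) :
    exponent R + R * (Real.exp (-exponent R) - 1) = 0 :=
  (isGreatest_exponent hR).1

/-- Since `r + R (e^{-r} - 1)` is nonnegative for `r ≥ R`, it has a root beyond any point where it
is negative. -/
theorem lt_exponent {R x : ℝ} (hR : 0 ≤ R) (hx : x + R * (Real.exp (-x) - 1) < 0) :
    x < exponent R := by
  have hmax : 0 ≤ max x R + R * (Real.exp (-max x R) - 1) := by
    nlinarith [le_max_right x R, mul_nonneg hR (Real.exp_pos (-max x R)).le]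
  have hcont : ContinuousOn (fun r : ℝ => r + R * (Real.exp (-r) - 1)) (Icc x (max x R)) := by
    fun_prop
  obtain ⟨r, hr, hr0⟩ := intermediate_value_Icc (le_max_left x R) hcont ⟨hx.le, hmax⟩
  have hne : x ≠ r := by
    rintro rfl
    exact hx.ne hr0
  exact (lt_of_le_of_ne hr.1 hne).trans_le ((isGreatest_exponent hR).2 hr0)

/-- The exponent function is negative at `log R`. -/
theorem exponent_pos {R : ℝ} (hR : 1 < R) : 0 < exponent R := by
  have hlog := Real.log_lt_sub_one_of_pos (by linarith) hR.ne'
  refine (Real.log_pos hR).trans (lt_exponent (by linarith) ?_)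
  rw [Real.exp_neg, Real.exp_log (by linarith), mul_sub, mul_inv_cancel₀ (by linarith)]
  linarith

theorem exponent_lt_exponent_add {R R' : ℝ} (hR : 1 < R) (hR' : 0 < R') :
    exponent R < exponent (R + R') := by
  have h0 := exponent_pos hR
  refine lt_exponent (by linarith) ?_
  have h1 := exponent_add_eq_zero (by linarith : 0 ≤ R)
  have h2 : Real.exp (-exponent R) < 1 := by
    rw [Real.exp_lt_one_iff]
    linarith
  nlinarith [mul_pos hR' (sub_pos.2 h2)]

/-! ### Exponential functions along one step -/

/-- With a root `α` of the exponent equation of rate `R`, the function `e^{-α y}` is exactly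
harmonic for a drain by `h` followed by a Poisson number of arrivals with mean `R h`. -/
theorem lintegral_exp_step {R α : ℝ} {r : ℝ≥0} (hα : α + R * (Real.exp (-α) - 1) = 0) {h : ℝ}
    (hr : (r : ℝ) = R * h) {c : ℝ} (hc : 0 ≤ c) (y : ℝ) :
    ∫⁻ i : ℕ, ENNReal.ofReal (c * Real.exp (-(α * (y - h + i)))) ∂poissonMeasure r =
      ENNReal.ofReal (c * Real.exp (-(α * y))) := by
  have h1 : ∀ i : ℕ, c * Real.exp (-(α * (y - h + i))) =
      c * Real.exp (-(α * (y - h))) * Real.exp (-(α * i)) := fun i => by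
    rw [mul_assoc, ← Real.exp_add]
    ring_nf
  simp_rw [h1]
  rw [lintegral_exp_poissonMeasure _ (by positivity), mul_assoc, ← Real.exp_add, hr]
  congr 3
  linear_combination h * hα

/-- The same for both servers together, with an additive constant. -/
theorem lintegral_add_exp_step {R₀ Rc h : ℝ≥0} {α : ℝ}
    (hα : α + (R₀ + Rc) * (Real.exp (-α) - 1) = 0) {A c : ℝ} (hA : 0 ≤ A) (hc : 0 ≤ c) (y : ℝ) :
    ∫⁻ i : ℕ, ∫⁻ j : ℕ, ENNReal.ofReal (A + c * Real.exp (-(α * (y - h + i + j))))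
      ∂poissonMeasure (Rc * h) ∂poissonMeasure (R₀ * h) =
      ENNReal.ofReal (A + c * Real.exp (-(α * y))) := by
  have h1 : ∀ i j : ℕ, ENNReal.ofReal (A + c * Real.exp (-(α * (y - h + i + j)))) =
      ENNReal.ofReal A + ENNReal.ofReal
        (c * Real.exp (-(α * (y - h + i))) * Real.exp (-(α * j))) := fun i j => by
    rw [← ENNReal.ofReal_add hA (by positivity), mul_assoc, ← Real.exp_add]
    ring_nf
  have h2 : ∀ i : ℕ, c * Real.exp (-(α * (y - h + i))) *
      Real.exp ((Rc * h : ℝ≥0) * (Real.exp (-α) - 1)) =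
      c * Real.exp ((Rc * h : ℝ≥0) * (Real.exp (-α) - 1) - α * (y - h)) *
        Real.exp (-(α * i)) := fun i => by
    rw [mul_assoc, mul_assoc, ← Real.exp_add, ← Real.exp_add]
    ring_nf
  simp_rw [h1]
  simp only [lintegral_add_left measurable_const, lintegral_const, measure_univ, mul_one]
  rw [lintegral_congr fun i => (lintegral_exp_poissonMeasure (Rc * h) (by positivity) α).trans
      (congrArg _ (h2 i)), lintegral_exp_poissonMeasure _ (by positivity), mul_assoc,
    ← Real.exp_add, ← ENNReal.ofReal_add hA (by positivity)]
  congr 4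
  push_cast
  linear_combination (h : ℝ) * hα

/-! ### The superharmonic bound on the risk -/

/-- Above the threshold, the bound for both servers dominates the one for the free server:
Bernoulli's inequality. -/
theorem mul_exp_le_sub_one_add_exp {α₀ α₁ β x : ℝ} (h0 : 0 < α₀) (h01 : α₀ ≤ α₁)
    (hβ : α₁ ≤ β * α₀) (hx : 0 ≤ x) :
    β * Real.exp (-(α₀ * x)) ≤ β - 1 + Real.exp (-(α₁ * x)) := by
  have hw1 : Real.exp (-(α₀ * x)) ≤ 1 := Real.exp_le_one_iff.2 (by nlinarith)
  have hw0 := Real.exp_pos (-(α₀ * x))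
  have hb := one_add_mul_self_le_rpow_one_add
    (s := Real.exp (-(α₀ * x)) - 1) (by linarith) ((one_le_div h0).2 h01)
  rw [add_sub_cancel, ← Real.exp_mul,
    show -(α₀ * x) * (α₁ / α₀) = -(α₁ * x) by field_simp] at hb
  have hk : α₁ / α₀ ≤ β := (div_le_iff₀ h0).2 hβ
  nlinarith

/-- Just below the threshold the domination is reversed, because the two bounds cross there with
different slopes. -/
theorem sub_one_add_exp_le_mul_exp {α₀ α₁ β u : ℝ} (h1 : 0 < α₁) (hβ : 0 ≤ β) (hu : 0 ≤ u)
    (hu1 : α₁ * u ≤ 1) (hu2 : α₁ ^ 2 * u ≤ β * α₀ - α₁) :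
    β - 1 + Real.exp (α₁ * u) ≤ β * Real.exp (α₀ * u) := by
  have hn : 0 ≤ α₁ * u := by positivity
  have hb := Real.abs_exp_sub_one_sub_id_le (x := α₁ * u) (by rwa [abs_of_nonneg hn])
  have hb' := (abs_le.1 hb).2
  have hc := mul_le_mul_of_nonneg_left (Real.add_one_le_exp (α₀ * u)) hβ
  nlinarith [mul_le_mul_of_nonneg_right hu2 hu]

/-- The risk of a buffer at `q` below a threshold `t`, when `E` stands for `e^{-α₁ t}`: a mixture of
`1` and `e^{-α₁ q}` with value `1` at `q = 0`. -/
noncomputable def riskBelow (α₁ β E q : ℝ) : ℝ :=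
  (E * (β - 1) + Real.exp (-(α₁ * q))) / (1 + E * (β - 1))

/-- An upper bound for the interruption probability under threshold `t`: `riskBelow` below `t`, and
a multiple of `e^{-α₀ q}` from `t` on, with equal values at `t`. -/
noncomputable def riskBound (α₀ α₁ β t q : ℝ) : ℝ :=
  if q < t then riskBelow α₁ β (Real.exp (-(α₁ * t))) q
  else β * Real.exp (-(α₁ * t)) * Real.exp (-(α₀ * (q - t))) /
    (1 + Real.exp (-(α₁ * t)) * (β - 1))

section RiskBound

variable {α₀ α₁ β t : ℝ}

theorem riskBound_le_riskBelow (h0 : 0 < α₀) (h01 : α₀ ≤ α₁) (hβ : α₁ ≤ β * α₀) (hβ1 : 1 ≤ β)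
    (q : ℝ) : riskBound α₀ α₁ β t q ≤ riskBelow α₁ β (Real.exp (-(α₁ * t))) q := by
  unfold riskBound
  split_ifs with hq
  · exact le_rfl
  · have hE := Real.exp_pos (-(α₁ * t))
    have hb := mul_le_mul_of_nonneg_left
      (mul_exp_le_sub_one_add_exp h0 h01 hβ (sub_nonneg.2 (not_lt.1 hq))) hE.le
    have hE' : Real.exp (-(α₁ * t)) * Real.exp (-(α₁ * (q - t))) = Real.exp (-(α₁ * q)) := by
      rw [← Real.exp_add]
      ring_nf
    have hden : 0 < 1 + Real.exp (-(α₁ * t)) * (β - 1) := by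
      nlinarith [mul_nonneg hE.le (sub_nonneg.2 hβ1)]
    unfold riskBelow
    gcongr
    linarith

/-- Slightly below the threshold, `riskBound` is still dominated by its upper branch. -/
theorem riskBound_le_of_sub_le (h1 : 0 < α₁) (hβ1 : 1 ≤ β) {h : ℝ}
    (hh1 : α₁ * h ≤ 1) (hh2 : α₁ ^ 2 * h ≤ β * α₀ - α₁) {q : ℝ} (hq : t - h ≤ q) :
    riskBound α₀ α₁ β t q ≤ β * Real.exp (-(α₁ * t)) * Real.exp (-(α₀ * (q - t))) /
      (1 + Real.exp (-(α₁ * t)) * (β - 1)) := by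
  unfold riskBound
  split_ifs with hqt
  · have hE := Real.exp_pos (-(α₁ * t))
    have hb := mul_le_mul_of_nonneg_left
      (sub_one_add_exp_le_mul_exp (α₀ := α₀) (β := β) (u := t - q) h1 (by linarith) (by linarith)
        (by nlinarith) (by nlinarith [sq_nonneg α₁])) hE.le
    have hE' : Real.exp (-(α₁ * t)) * Real.exp (α₁ * (t - q)) = Real.exp (-(α₁ * q)) := by
      rw [← Real.exp_add]
      ring_nf
    have hden : 0 < 1 + Real.exp (-(α₁ * t)) * (β - 1) := by
      nlinarith [mul_nonneg hE.le (sub_nonneg.2 hβ1)]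
    rw [show -(α₀ * (q - t)) = α₀ * (t - q) by ring]
    unfold riskBelow
    gcongr
    linarith
  · exact le_rfl

theorem lintegral_riskBelow {R₀ Rc h : ℝ≥0} (hα : α₁ + (R₀ + Rc) * (Real.exp (-α₁) - 1) = 0)
    (hβ1 : 1 ≤ β) {E : ℝ} (hE : 0 ≤ E) (y : ℝ) :
    ∫⁻ i : ℕ, ∫⁻ j : ℕ, ENNReal.ofReal (riskBelow α₁ β E (y - h + i + j))
      ∂poissonMeasure (Rc * h) ∂poissonMeasure (R₀ * h) = ENNReal.ofReal (riskBelow α₁ β E y) := by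
  have hn : 0 ≤ E * (β - 1) := mul_nonneg hE (sub_nonneg.2 hβ1)
  have := lintegral_add_exp_step (h := h) hα (A := E * (β - 1) / (1 + E * (β - 1)))
    (c := (1 + E * (β - 1))⁻¹) (by positivity) (by positivity) y
  simpa only [riskBelow, add_div, div_eq_inv_mul (Real.exp _)] using this

theorem isSuperharmonicStep_riskBelow {R₀ Rc h : ℝ≥0}
    (hα : α₁ + (R₀ + Rc) * (Real.exp (-α₁) - 1) = 0) (hβ1 : 1 ≤ β) {E : ℝ} (hE : 0 ≤ E) :
    IsSuperharmonicStep R₀ Rc ⊤ (riskBelow α₁ β E) h := by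
  intro y _
  simp only [EReal.coe_lt_top, if_true]
  exact (lintegral_riskBelow hα hβ1 hE y).le

/-- From below the threshold, `riskBound` is dominated by `riskBelow`, which is harmonic for both
servers. From the threshold on, one step of length `h` ends above `t - h`, where `riskBound` is
dominated by its upper branch, which is harmonic for the free server. -/
theorem isSuperharmonicStep_riskBound {R₀ Rc h : ℝ≥0}
    (hr0 : α₀ + R₀ * (Real.exp (-α₀) - 1) = 0)
    (hr1 : α₁ + (R₀ + Rc) * (Real.exp (-α₁) - 1) = 0)
    (h0 : 0 < α₀) (h01 : α₀ ≤ α₁) (hβ : α₁ ≤ β * α₀) (hβ1 : 1 ≤ β)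
    (hh1 : α₁ * h ≤ 1) (hh2 : α₁ ^ 2 * h ≤ β * α₀ - α₁) :
    IsSuperharmonicStep R₀ Rc t (riskBound α₀ α₁ β t) h := by
  intro y _
  have hE := Real.exp_pos (-(α₁ * t))
  have hn : 0 ≤ Real.exp (-(α₁ * t)) * (β - 1) := mul_nonneg hE.le (sub_nonneg.2 hβ1)
  by_cases hy : y < t
  · simp only [EReal.coe_lt_coe_iff, hy, if_true]
    refine (lintegral_mono fun i => lintegral_mono fun j => ENNReal.ofReal_le_ofReal
      (riskBound_le_riskBelow h0 h01 hβ hβ1 _)).trans ?_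
    rw [lintegral_riskBelow hr1 hβ1 hE.le, riskBound, if_pos hy]
  · simp only [EReal.coe_lt_coe_iff, hy, if_false, Nat.cast_zero, add_zero, lintegral_const,
      measure_univ, mul_one]
    set c := β * Real.exp (-(α₁ * t)) * Real.exp (α₀ * t) / (1 + Real.exp (-(α₁ * t)) * (β - 1))
      with hc
    have hc0 : 0 ≤ c := by positivity
    have hform : ∀ q, β * Real.exp (-(α₁ * t)) * Real.exp (-(α₀ * (q - t))) /
        (1 + Real.exp (-(α₁ * t)) * (β - 1)) = c * Real.exp (-(α₀ * q)) := fun q => by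
      rw [show -(α₀ * (q - t)) = α₀ * t + -(α₀ * q) by ring, Real.exp_add, hc]
      ring
    refine (lintegral_mono fun i => ENNReal.ofReal_le_ofReal ((riskBound_le_of_sub_le
      (h0.trans_le h01) hβ1 hh1 hh2 ?_).trans (hform _).le)).trans ?_
    · have : (0 : ℝ) ≤ i := i.cast_nonneg
      linarith [not_lt.1 hy]
    · rw [lintegral_exp_step (R := R₀) hr0 (by push_cast; ring) hc0, riskBound, if_neg hy, hform]

theorem riskBelow_nonneg (hβ1 : 1 ≤ β) {E : ℝ} (hE : 0 ≤ E) (q : ℝ) : 0 ≤ riskBelow α₁ β E q := by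
  have := mul_nonneg hE (sub_nonneg.2 hβ1)
  unfold riskBelow
  positivity

theorem riskBound_nonneg (hβ1 : 1 ≤ β) (q : ℝ) : 0 ≤ riskBound α₀ α₁ β t q := by
  unfold riskBound
  split_ifs
  · exact riskBelow_nonneg hβ1 (Real.exp_pos _).le q
  · have := mul_nonneg (Real.exp_pos (-(α₁ * t))).le (sub_nonneg.2 hβ1)
    positivity

theorem riskBelow_anti (h1 : 0 ≤ α₁) (hβ1 : 1 ≤ β) {E : ℝ} (hE : 0 ≤ E) {q q' : ℝ} (hq : q ≤ q') :
    riskBelow α₁ β E q' ≤ riskBelow α₁ β E q := by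
  have := mul_nonneg hE (sub_nonneg.2 hβ1)
  unfold riskBelow
  gcongr

theorem tendsto_riskBelow_zero (hβ1 : 1 ≤ β) {E : ℝ} (hE : 0 ≤ E) :
    Tendsto (riskBelow α₁ β E) (𝓝[>] 0) (𝓝 1) := by
  have hn := mul_nonneg hE (sub_nonneg.2 hβ1)
  have hcont : Continuous (riskBelow α₁ β E) := by
    unfold riskBelow
    fun_prop
  have h1 : riskBelow α₁ β E 0 = 1 := by
    unfold riskBelow
    rw [mul_zero, neg_zero, Real.exp_zero, add_comm, div_self (by positivity)]
  simpa only [h1] using (hcont.tendsto 0).mono_left (nhdsWithin_le_nhds (s := Ioi 0))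

end RiskBound

section Interruption

variable {Ω : Type*} [MeasurableSpace Ω] {P : Measure Ω} [IsProbabilityMeasure P]
  {R₀ Rc : ℝ≥0} {N Nc : ℝ≥0 → Ω → ℕ} {α₀ α₁ β D : ℝ} {Q : ℝ≥0 → Ω → ℝ}

/-- Without a threshold, `riskBelow` with `E = 0` is `e^{-α₁ q}`. -/
theorem interruptionProb_le_exp (hN : IsPoissonProcess N R₀ P) (hNc : IsPoissonProcess Nc Rc P)
    (hindep : IndepFun (fun ω t => N t ω) (fun ω t => Nc t ω) P)
    (hr1 : α₁ + (R₀ + Rc) * (Real.exp (-α₁) - 1) = 0) (h1 : 0 ≤ α₁) (hD : 0 < D)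
    (hQ : IsBufferProcess P N Nc (riskyPolicy ⊤) D Q) :
    interruptionProb P Q ≤ Real.exp (-(α₁ * D)) := by
  have := interruptionProb_le_of_isSuperharmonicStep hN hNc hindep hD hQ
    (riskBelow_nonneg (α₁ := α₁) le_rfl le_rfl D) (tendsto_riskBelow_zero le_rfl le_rfl)
    (Eventually.of_forall fun h => ⟨isSuperharmonicStep_riskBelow hr1 le_rfl le_rfl,
      fun y _ hy => riskBelow_anti h1 le_rfl le_rfl hy⟩)
  simpa [riskBelow] using this

theorem interruptionProb_le_riskBound (hN : IsPoissonProcess N R₀ P)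
    (hNc : IsPoissonProcess Nc Rc P)
    (hindep : IndepFun (fun ω t => N t ω) (fun ω t => Nc t ω) P)
    (hr0 : α₀ + R₀ * (Real.exp (-α₀) - 1) = 0)
    (hr1 : α₁ + (R₀ + Rc) * (Real.exp (-α₁) - 1) = 0)
    (h0 : 0 < α₀) (h01 : α₀ ≤ α₁) (hβ : α₁ < β * α₀) (hβ1 : 1 ≤ β) (hD : 0 < D) {t : ℝ}
    (ht : 0 < t) (hQ : IsBufferProcess P N Nc (riskyPolicy t) D Q) :
    interruptionProb P Q ≤ riskBound α₀ α₁ β t D := by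
  have h1 : 0 < α₁ := h0.trans_le h01
  have hE := (Real.exp_pos (-(α₁ * t))).le
  refine interruptionProb_le_of_isSuperharmonicStep hN hNc hindep hD hQ
    (riskBound_nonneg hβ1 D) ?_ ?_
  · refine (tendsto_riskBelow_zero (α₁ := α₁) hβ1 hE).congr' ?_
    filter_upwards [Ioo_mem_nhdsGT ht] with q hq
    rw [riskBound, if_pos hq.2]
  · have hsmall : ∀ c d : ℝ, 0 < d → ∀ᶠ h : ℝ≥0 in 𝓝[>] 0, c * h < d := fun c d hd => by
      have : Tendsto (fun h : ℝ≥0 => c * (h : ℝ)) (𝓝[>] 0) (𝓝 (c * (0 : ℝ≥0))) :=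
        (Continuous.tendsto (by fun_prop) 0).mono_left nhdsWithin_le_nhds
      exact this.eventually (gt_mem_nhds (by simpa using hd))
    -- the first two bounds make the branches cross in the right order, the third one puts the mesh
    -- below the threshold, where `riskBound` is decreasing
    filter_upwards [hsmall α₁ 1 one_pos, hsmall (α₁ ^ 2) (β * α₀ - α₁) (sub_pos.2 hβ),
      hsmall 1 t ht] with h hh1 hh2 hht
    rw [one_mul] at hht
    refine ⟨isSuperharmonicStep_riskBound hr0 hr1 h0 h01 hβ.le hβ1 hh1.le hh2.le,
      fun y _ hy => ?_⟩
    rw [riskBound, riskBound, if_pos hht, if_pos (hy.trans_lt hht)]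
    exact riskBelow_anti h1.le hβ1 hE hy

end Interruption

/-! ### The threshold -/

section Threshold

variable {α₀ α₁ D ε : ℝ}

/-- The factor `1 / (1 - α₀ / 2)` in `β` exceeds `1`, which leaves room for the two branches of
`riskBound` to cross transversally at the threshold. -/
theorem lt_beta_mul (h0 : 0 < α₀) (h1 : 0 < α₁) (h2 : α₀ < 2) : α₁ < beta α₀ α₁ * α₀ := by
  have hpos : 0 < 1 - α₀ / 2 := by linarith
  have : beta α₀ α₁ * α₀ = α₁ / (1 - α₀ / 2) := by
    unfold beta
    field_simp
  rw [this, lt_div_iff₀ hpos]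
  nlinarith

/-- Below the breakpoint (`ε < β e^{-α₁ D}`) any admissible threshold exceeds the initial buffer
size, so that `riskBelow` is the relevant bound. It is at most `ε` as soon as
`e^{-α₁ t} (β - 1) (1 - ε) ≤ ε - e^{-α₁ D}`, which the threshold implies because
`(β - 1) (1 - ε) ≤ ε + β (1 - e^{-α₁ D}) - 1`. -/
theorem riskBound_le_of_lt_breakpoint {β t : ℝ} (h1 : 0 < α₁) (hε1 : ε < 1)
    (hxε : Real.exp (-(α₁ * D)) < ε) (hb : ε < β * Real.exp (-(α₁ * D)))
    (ht : 1 / α₁ * Real.log ((ε + β * (1 - Real.exp (-(α₁ * D))) - 1) /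
      (ε - Real.exp (-(α₁ * D)))) ≤ t) :
    D < t ∧ riskBound α₀ α₁ β t D ≤ ε := by
  set x := Real.exp (-(α₁ * D)) with hx
  have hx0 : 0 < x := Real.exp_pos _
  -- the argument of the logarithm exceeds `1 / x = e^{α₁ D}`
  have hnum : ε - x < x * (ε + β * (1 - x) - 1) := by
    nlinarith [mul_pos (sub_pos.2 hb) (sub_pos.2 (hxε.trans hε1))]
  have hnum0 : 0 < ε + β * (1 - x) - 1 := by
    by_contra hcon
    nlinarith [mul_nonpos_of_nonneg_of_nonpos hx0.le (not_lt.1 hcon)]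
  have hden0 : 0 < ε - x := sub_pos.2 hxε
  rw [one_div, inv_mul_le_iff₀ h1, Real.log_le_iff_le_exp (by positivity),
    div_le_iff₀ hden0] at ht
  have hDt : D < t := by
    have h3 : Real.exp (-(α₁ * t)) < x := by
      rw [Real.exp_neg, inv_lt_comm₀ (Real.exp_pos _) hx0, inv_eq_one_div, div_lt_iff₀ hx0]
      by_contra hcon
      nlinarith [not_lt.1 hcon]
    rw [hx, Real.exp_lt_exp] at h3
    nlinarith
  refine ⟨hDt, ?_⟩
  have hE := Real.exp_pos (-(α₁ * t))
  have hEinv : Real.exp (-(α₁ * t)) * Real.exp (α₁ * t) = 1 := by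
    rw [← Real.exp_add]
    simp
  have hE2 : Real.exp (-(α₁ * t)) * (ε + β * (1 - x) - 1) ≤ ε - x := by
    have := mul_le_mul_of_nonneg_left ht hE.le
    rwa [← mul_assoc, hEinv, one_mul] at this
  have hn : 0 ≤ Real.exp (-(α₁ * t)) * (β - 1) := mul_nonneg hE.le (by linarith)
  rw [riskBound, if_pos hDt, riskBelow, div_le_iff₀ (by linarith), ← hx]
  nlinarith [mul_nonneg hE.le (mul_nonneg (by linarith : 0 ≤ β) hden0.le)]

/-- Beyond the breakpoint (`β e^{-α₁ D} ≤ ε`) the threshold may lie on either side of the initial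
buffer size: above it, `β e^{-α₁ D}` already bounds the risk; below it, the threshold makes
`β e^{-α₁ t} e^{-α₀ (D - t)}` at most `ε`. -/
theorem riskBound_le_of_breakpoint_le {β t : ℝ} (h1 : 0 < α₁) (h01 : α₀ < α₁) (hβ1 : 1 ≤ β)
    (hε : 0 < ε) (hb : β * Real.exp (-(α₁ * D)) ≤ ε)
    (ht : 1 / (α₁ - α₀) * (Real.log (β / ε) - α₀ * D) ≤ t) : riskBound α₀ α₁ β t D ≤ ε := by
  have hE := Real.exp_pos (-(α₁ * t))
  have hn : 0 ≤ Real.exp (-(α₁ * t)) * (β - 1) := mul_nonneg hE.le (by linarith)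
  have hβ0 : 0 < β := by linarith
  unfold riskBound
  split_ifs with hDt
  · have hEx : Real.exp (-(α₁ * t)) ≤ Real.exp (-(α₁ * D)) :=
      Real.exp_le_exp.2 (by nlinarith)
    rw [riskBelow, div_le_iff₀ (by linarith)]
    nlinarith [mul_le_mul_of_nonneg_right hEx (sub_nonneg.2 hβ1), mul_nonneg hε.le hn]
  · rw [one_div, inv_mul_le_iff₀ (sub_pos.2 h01), sub_le_iff_le_add,
      Real.log_le_iff_le_exp (by positivity), div_le_iff₀ hε] at ht
    have hexp : Real.exp ((α₁ - α₀) * t + α₀ * D) *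
        (Real.exp (-(α₁ * t)) * Real.exp (-(α₀ * (D - t)))) = 1 := by
      rw [← Real.exp_add, ← Real.exp_add, Real.exp_eq_one_iff]
      ring
    have := mul_le_mul_of_nonneg_right ht
      (mul_pos hE (Real.exp_pos (-(α₀ * (D - t))))).le
    rw [mul_right_comm, hexp, one_mul] at this
    rw [div_le_iff₀ (by linarith)]
    nlinarith [mul_nonneg hε.le hn]

end Threshold

end Streaming

open Streaming in
theorem mainTheorem6 {Ω : Type*} [MeasurableSpace Ω] (P : Measure Ω) [IsProbabilityMeasure P]
    (R₀ Rc : ℝ≥0) (hR₀ : 1 < R₀) (hRc : 0 < Rc)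
    (hα₀ : Streaming.exponent (R₀ : ℝ) < 2)
    (N Nc : ℝ≥0 → Ω → ℕ)
    (hN : Streaming.IsPoissonProcess N R₀ P) (hNc : Streaming.IsPoissonProcess Nc Rc P)
    (hindep : IndepFun (fun ω t => N t ω) (fun ω t => Nc t ω) P)
    (α₀ α₁ : ℝ) (hα₀_def : α₀ = Streaming.exponent (R₀ : ℝ))
    (hα₁_def : α₁ = Streaming.exponent ((R₀ + Rc : ℝ≥0) : ℝ))
    (D ε : ℝ) (hregion : (D, ε) ∈ Streaming.region α₀ α₁)
    (T : EReal) (hT : Streaming.riskyThreshold α₀ α₁ D ε ≤ T)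
    (Q : ℝ≥0 → Ω → ℝ)
    (hQ : Streaming.IsBufferProcess P N Nc (Streaming.riskyPolicy T) D Q) :
    Streaming.interruptionProb P Q ≤ ε := by
  have hR₀' : (1 : ℝ) < R₀ := hR₀
  have hRc' : (0 : ℝ) < Rc := hRc
  have h0 : 0 < α₀ := hα₀_def ▸ exponent_pos hR₀'
  have h01 : α₀ < α₁ := by
    rw [hα₀_def, hα₁_def, NNReal.coe_add]
    exact exponent_lt_exponent_add hR₀' hRc'
  have h1 : 0 < α₁ := h0.trans h01
  have hr0 : α₀ + R₀ * (Real.exp (-α₀) - 1) = 0 :=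
    hα₀_def ▸ exponent_add_eq_zero R₀.coe_nonneg
  have hr1 : α₁ + (R₀ + Rc) * (Real.exp (-α₁) - 1) = 0 := by
    have := exponent_add_eq_zero (R₀ + Rc : ℝ≥0).coe_nonneg
    rwa [← hα₁_def, NNReal.coe_add] at this
  obtain ⟨hε, hlow, hup⟩ := hregion
  simp only at hε hlow hup
  -- for `ε ≥ 1` the claim is trivial; otherwise the region forces `D > 0`
  rcases le_or_gt 1 ε with hε1 | hε1
  · exact measureReal_le_one.trans hε1
  rw [one_div, one_div ε, Real.log_inv, inv_mul_le_iff₀ h1] at hlow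
  rw [one_div, one_div ε, Real.log_inv, ← div_eq_inv_mul, le_div_iff₀ h0] at hup
  have hlog : Real.log ε < 0 := Real.log_neg hε hε1
  have hD : 0 < D := by
    by_contra hcon
    nlinarith [not_lt.1 hcon]
  have hxε : Real.exp (-(α₁ * D)) ≤ ε := by
    rw [← Real.le_log_iff_exp_le hε]
    linarith
  have hβ := lt_beta_mul h0 h1 (hα₀_def ▸ hα₀)
  set β := Streaming.beta α₀ α₁ with hβdef
  have hβ1 : 1 < β := by
    by_contra hcon
    nlinarith [not_lt.1 hcon]
  -- the initial buffer is beyond the breakpoint iff `β e^{-α₁ D} ≤ ε`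
  have hbreak : breakpoint α₀ α₁ ε ≤ D ↔ β * Real.exp (-(α₁ * D)) ≤ ε := by
    rw [breakpoint, one_div, inv_mul_le_iff₀ h1, Real.log_le_iff_le_exp (by positivity),
      div_le_iff₀ hε, Real.exp_neg, ← div_eq_mul_inv, div_le_iff₀ (Real.exp_pos _), mul_comm ε]
  induction T with
  | top => exact (interruptionProb_le_exp hN hNc hindep hr1 h1.le hD hQ).trans hxε
  | bot =>
    unfold riskyThreshold at hT
    split_ifs at hT
    exacts [absurd (le_bot_iff.1 hT) (EReal.coe_ne_bot _), absurd (le_bot_iff.1 hT) top_ne_bot,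
      absurd (le_bot_iff.1 hT) (EReal.coe_ne_bot _)]
  | coe t =>
    have hkey : 0 < t ∧ riskBound α₀ α₁ β t D ≤ ε := by
      unfold riskyThreshold at hT
      split_ifs at hT with hb he
      · rw [EReal.coe_le_coe_iff] at hT
        refine ⟨lt_of_lt_of_le ?_ hT, riskBound_le_of_breakpoint_le h1 h01 hβ1.le hε
          (hbreak.1 hb) hT⟩
        have hlogβ := Real.log_pos hβ1
        rw [Real.log_div (by linarith) hε.ne']
        exact mul_pos (one_div_pos.2 (sub_pos.2 h01)) (by linarith)
      · -- on the lower boundary the threshold is infinite, so no finite `t` is admissible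
        simp at hT
      · rw [EReal.coe_le_coe_iff] at hT
        have := riskBound_le_of_lt_breakpoint (α₀ := α₀) h1 hε1
          (lt_of_le_of_ne hxε (Ne.symm he)) (not_le.1 (mt hbreak.2 hb)) hT
        exact ⟨hD.trans this.1, this.2⟩
    exact (interruptionProb_le_riskBound hN hNc hindep hr0 hr1 h0 h01.le hβ hβ1.le hD hkey.1
      hQ).trans hkey.2
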